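/- Let $\mathcal{A}$ be a unital $C^*$-algebra with center $Z(\mathcal{A})$, let $H_{\mathcal{A}}=\ell^2(\mathcal{A})$ be the standard (right) Hilbert $\mathcal{A}$-module of sequences $(x_i)_{i\in\mathbb{N}}$ in $\mathcal{A}$ for which $\sum_i x_i^*x_i$ converges in norm, with inner product $\langle x,y\rangle=\sum_i x_i^*y_i$, and let $B^a(H_{\mathcal{A}})$ be the set of bounded adjointable $\mathcal{A}$-linear operators on $H_{\mathcal{A}}$. For $\alpha\in Z(\mathcal{A})$ let $\alpha I\in B^a(H_{\mathcal{A}})$ be the operator $x\mapsto x\alpha$. For $T\in B^a(H_{\mathcal{A}})$, a *decomposition for $T$* consists of closed submodules $M_1,N_1,M_2,N_2$ of $H_{\mathcal{A}}$ with $H_{\mathcal{A}}=M_1\tilde\oplus N_1=M_2\tilde\oplus N_2$ (direct sums, not necessarily orthogonal) with respect to which $T$ has the matrix $\begin{pmatrix}T_1&0\\0&T_4\end{pmatrix}$, where $T_1:M_1\to M_2$ is an isomorphism. The operator $T$ is *upper semi-$\mathcal{A}$-Fredholm* ($T\in\mathcal{M}\Phi_+(H_{\mathcal{A}})$) if it has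 a decomposition with $N_1$ finitely generated, *lower semi-$\mathcal{A}$-Fredholm* ($T\in\mathcal{M}\Phi_-(H_{\mathcal{A}})$) if it has a decomposition with $N_2$ finitely generated, and *$\mathcal{A}$-Fredholm* ($T\in\mathcal{M}\Phi(H_{\mathcal{A}})$) if it has a decomposition with both $N_1$ and $N_2$ finitely generated. In the last case $\operatorname{index}T=[N_1]-[N_2]\in K_0(\mathcal{A})$, which does not depend on the choice of such a decomposition, and $\mathcal{M}\Phi_0(H_{\mathcal{A}})$ is the set of all $\mathcal{A}$-Fredholm operators of index $0$. For $F\in B^a(H_{\mathcal{A}})$ define the following subsets of $Z(\mathcal{A})$: $$\sigma_{ew}^{\mathcal{A}}(F)=\{\alpha\in Z(\mathcal{A})\mid F-\alpha I\notin\mathcal{M}\Phi_0(H_{\mathcal{A}})\},\qquad \sigma_{ef}^{\mathcal{A}}(F)=\{\alpha\in Z(\mathcal{A})\mid F-\alpha I\notin\mathcal{M}\Phi(H_{\mathcal{A}})\},$$ $$\sigma_{e\alpha}^{\mathcal{A}}(F)=\{\alpha\in Z(\mathcal{A})\mid F-\alpha I\notin\mathcal{M}\Phi_+(H_{\mathcal{A}})\},\qquad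 \sigma_{e\beta}^{\mathcal{A}}(F)=\{\alpha\in Z(\mathcal{A})\mid F-\alpha I\notin\mathcal{M}\Phi_-(H_{\mathcal{A}})\},$$ $$\sigma_{ek}^{\mathcal{A}}(F)=\{\alpha\in Z(\mathcal{A})\mid F-\alpha I\notin\mathcal{M}\Phi_+(H_{\mathcal{A}})\cup\mathcal{M}\Phi_-(H_{\mathcal{A}})\}.$$ **Theorem.** Let $F\in B^a(H_{\mathcal{A}})$. With boundaries taken in the $C^*$-algebra $Z(\mathcal{A})$ with its norm topology, $$\partial\sigma_{ew}^{\mathcal{A}}(F)\subseteq\partial\sigma_{ef}^{\mathcal{A}}(F),\qquad \partial\sigma_{ef}^{\mathcal{A}}(F)\subseteq\partial\sigma_{e\beta}^{\mathcal{A}}(F),\qquad \partial\sigma_{ef}^{\mathcal{A}}(F)\subseteq\partial\sigma_{e\alpha}^{\mathcal{A}}(F),$$ $$\partial\sigma_{e\beta}^{\mathcal{A}}(F)\subseteq\partial\sigma_{ek}^{\mathcal{A}}(F),\qquad \partial\sigma_{e\alpha}^{\mathcal{A}}(F)\subseteq\partial\sigma_{ek}^{\mathcal{A}}(F).$$ 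-/

import Mathlib

open Filter Topology

noncomputable section

namespace SemiFredholm

universe u

variable {A : Type u} [CStarAlgebra A]

/-! ### The standard Hilbert module -/

/-- Finite Cauchy-Schwarz inequality for `A`-valued inner products. -/
theorem norm_sum_star_mul_le (s : Finset ℕ) (x y : ℕ → A) :
    ‖∑ i ∈ s, star (x i) * y i‖ ≤
      √‖∑ i ∈ s, star (x i) * x i‖ * √‖∑ i ∈ s, star (y i) * y i‖ := by
  let _ : PartialOrder Aᵐᵒᵖ := CStarAlgebra.spectralOrder Aᵐᵒᵖ
  have _ : StarOrderedRing Aᵐᵒᵖ := CStarAlgebra.spectralOrderedRing Aᵐᵒᵖ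
  let v : (ℕ → A) → WithCStarModule Aᵐᵒᵖ (s → Aᵐᵒᵖ) := fun z =>
    (WithCStarModule.equiv Aᵐᵒᵖ (s → Aᵐᵒᵖ)).symm fun i => MulOpposite.op (z i)
  have hin : ∀ z w, inner Aᵐᵒᵖ (v z) (v w) = MulOpposite.op (∑ i ∈ s, star (z i) * w i) := by
    intro z w
    rw [WithCStarModule.pi_inner, ← Finset.sum_coe_sort s, Finset.op_sum]
    rfl
  have hn : ∀ z, ‖v z‖ = √‖∑ i ∈ s, star (z i) * z i‖ := by
    intro z
    rw [CStarModule.norm_eq_sqrt_norm_inner_self (A := Aᵐᵒᵖ), hin, MulOpposite.norm_op]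
  have := CStarModule.norm_inner_le (A := Aᵐᵒᵖ) (WithCStarModule Aᵐᵒᵖ (s → Aᵐᵒᵖ))
    (x := v x) (y := v y)
  rwa [hin, hn, hn, MulOpposite.norm_op] at this

theorem sqrt_norm_sum_add_le (s : Finset ℕ) (x y : ℕ → A) :
    √‖∑ i ∈ s, star (x i + y i) * (x i + y i)‖ ≤
      √‖∑ i ∈ s, star (x i) * x i‖ + √‖∑ i ∈ s, star (y i) * y i‖ := by
  rw [Real.sqrt_le_left (by positivity)]
  have h : ∑ i ∈ s, star (x i + y i) * (x i + y i) =
      ∑ i ∈ s, star (x i) * x i + ∑ i ∈ s, star (x i) * y i + ∑ i ∈ s, star (y i) * x i +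
        ∑ i ∈ s, star (y i) * y i := by
    simp only [← Finset.sum_add_distrib]
    refine Finset.sum_congr rfl fun i _ => ?_
    rw [star_add]; noncomm_ring
  have h1 := norm_sum_star_mul_le s x y
  have h2 := norm_sum_star_mul_le s y x
  have h3 := norm_add_le (∑ i ∈ s, star (x i) * x i + ∑ i ∈ s, star (x i) * y i +
    ∑ i ∈ s, star (y i) * x i) (∑ i ∈ s, star (y i) * y i)
  have h4 := norm_add₃_le (a := ∑ i ∈ s, star (x i) * x i) (b := ∑ i ∈ s, star (x i) * y i)
    (c := ∑ i ∈ s, star (y i) * x i)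
  have h5 := Real.sq_sqrt (norm_nonneg (∑ i ∈ s, star (x i) * x i))
  have h6 := Real.sq_sqrt (norm_nonneg (∑ i ∈ s, star (y i) * y i))
  rw [h]
  nlinarith

theorem norm_sum_mono {s t : Finset ℕ} (h : s ⊆ t) (x : ℕ → A) :
    ‖∑ i ∈ s, star (x i) * x i‖ ≤ ‖∑ i ∈ t, star (x i) * x i‖ := by
  let _ : PartialOrder A := CStarAlgebra.spectralOrder A
  have _ : StarOrderedRing A := CStarAlgebra.spectralOrderedRing A
  exact CStarAlgebra.norm_le_norm_of_nonneg_of_le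
    (Finset.sum_nonneg fun i _ => star_mul_self_nonneg _)
    (Finset.sum_le_sum_of_subset_of_nonneg h fun i _ _ => star_mul_self_nonneg _)

theorem summable_star_mul {x y : ℕ → A} (hx : Summable fun i => star (x i) * x i)
    (hy : Summable fun i => star (y i) * y i) : Summable fun i => star (x i) * y i := by
  rw [summable_iff_vanishing_norm] at hx hy ⊢
  intro ε hε
  obtain ⟨s, hs⟩ := hx ε hε
  obtain ⟨t, ht⟩ := hy ε hε
  refine ⟨s ∪ t, fun r hr => ?_⟩
  rw [Finset.disjoint_union_right] at hr
  have h1 := Real.sqrt_lt_sqrt (norm_nonneg _) (hs r hr.1)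
  have h2 := Real.sqrt_lt_sqrt (norm_nonneg _) (ht r hr.2)
  calc _ ≤ _ := norm_sum_star_mul_le r x y
    _ < √ε * √ε := by gcongr
    _ = ε := Real.mul_self_sqrt hε.le

variable (A) in
/-- The sequences `x` in `A` for which `∑ xᵢ* xᵢ` converges in norm, as a right `A`-module (that is,
a module over the opposite algebra, `op a • x = x a`). -/
def stdSubmodule : Submodule Aᵐᵒᵖ (ℕ → A) where
  carrier := {x | Summable fun i => star (x i) * x i}
  zero_mem' := by simp
  add_mem' := by
    intro x y hx hy
    have h := ((hx.add (summable_star_mul hx hy)).add (summable_star_mul hy hx)).add hy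
    refine h.congr fun i => ?_
    simp only [Pi.add_apply, star_add]
    noncomm_ring
  smul_mem' := by
    intro a x hx
    refine ((hx.mul_left (star a.unop)).mul_right a.unop).congr fun i => ?_
    simp [mul_assoc]

variable (A) in
/-- The standard Hilbert module `H_A = ℓ²(A)` over the unital C*-algebra `A`. -/
def StdModule : Type u := stdSubmodule A

namespace StdModule

instance : AddCommGroup (StdModule A) := inferInstanceAs (AddCommGroup (stdSubmodule A))
instance : Module Aᵐᵒᵖ (StdModule A) := inferInstanceAs (Module Aᵐᵒᵖ (stdSubmodule A))
instance : Module ℂ (StdModule A) := inferInstanceAs (Module ℂ (stdSubmodule A))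
instance : IsScalarTower ℂ Aᵐᵒᵖ (StdModule A) :=
  inferInstanceAs (IsScalarTower ℂ Aᵐᵒᵖ (stdSubmodule A))

/-- The `A`-valued inner product `⟨x, y⟩ = ∑ xᵢ* yᵢ`. -/
def ip (x y : StdModule A) : A := ∑' i, star (x.1 i) * y.1 i

theorem hasSum_ip (x y : StdModule A) : HasSum (fun i => star (x.1 i) * y.1 i) (ip x y) :=
  (summable_star_mul x.2 y.2).hasSum

/-- The norm of a Hilbert module, `‖x‖ = ‖⟨x, x⟩‖ ^ (1/2)`. -/
instance : Norm (StdModule A) := ⟨fun x => √‖ip x x‖⟩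

theorem norm_def (x : StdModule A) : ‖x‖ = √‖ip x x‖ := rfl

theorem tendsto_norm (x : StdModule A) :
    Tendsto (fun s : Finset ℕ => √‖∑ i ∈ s, star (x.1 i) * x.1 i‖) atTop (𝓝 ‖x‖) :=
  (Real.continuous_sqrt.tendsto _).comp ((hasSum_ip x x).norm)

theorem sqrt_norm_sum_le (x : StdModule A) (s : Finset ℕ) :
    √‖∑ i ∈ s, star (x.1 i) * x.1 i‖ ≤ ‖x‖ := by
  refine ge_of_tendsto (tendsto_norm x) ?_
  filter_upwards [eventually_ge_atTop s] with t ht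
  exact Real.sqrt_le_sqrt (norm_sum_mono ht _)

theorem norm_coord_le (x : StdModule A) (i : ℕ) : ‖x.1 i‖ ≤ ‖x‖ := by
  have := sqrt_norm_sum_le x {i}
  rwa [Finset.sum_singleton, CStarRing.norm_star_mul_self, Real.sqrt_mul_self (norm_nonneg _)]
    at this

theorem normCore : NormedSpace.Core ℂ (StdModule A) where
  norm_nonneg x := Real.sqrt_nonneg _
  norm_eq_zero_iff x := by
    constructor
    · intro h
      refine Subtype.ext (funext fun i => ?_)
      have := norm_coord_le x i
      rw [h] at this
      exact norm_le_zero_iff.1 this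
    · rintro rfl
      have : ip (0 : StdModule A) 0 = 0 := by
        have h := hasSum_ip (0 : StdModule A) 0
        have h0 : (fun i => star ((0 : StdModule A).1 i) * (0 : StdModule A).1 i) = fun _ => 0 := by
          funext i
          exact mul_zero _
        rw [h0] at h
        exact h.unique hasSum_zero
      simp [norm_def, this]
  norm_smul c x := by
    have h : ip (c • x) (c • x) = (star c * c) • ip x x := by
      refine (hasSum_ip (c • x) (c • x)).unique ?_
      convert! (hasSum_ip x x).const_smul (star c * c) using 2 with i
      change star (c • x.1 i) * (c • x.1 i) = _
      rw [star_smul, smul_mul_smul_comm]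
    rw [norm_def, h, norm_smul, norm_def, CStarRing.norm_star_mul_self,
      Real.sqrt_mul (by positivity), Real.sqrt_mul_self (norm_nonneg _)]
  norm_triangle x y :=
    le_of_tendsto_of_tendsto' (tendsto_norm (x + y)) ((tendsto_norm x).add (tendsto_norm y))
      fun s => sqrt_norm_sum_add_le s x.1 y.1

instance : NormedAddCommGroup (StdModule A) := NormedAddCommGroup.ofCore normCore
instance : NormedSpace ℂ (StdModule A) := NormedSpace.ofCore normCore

theorem norm_op_smul_le (a : Aᵐᵒᵖ) (x : StdModule A) : ‖a • x‖ ≤ ‖a‖ * ‖x‖ := by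
  have h : ip (a • x) (a • x) = star a.unop * ip x x * a.unop := by
    refine (hasSum_ip (a • x) (a • x)).unique ?_
    convert! ((hasSum_ip x x).mul_left (star a.unop)).mul_right a.unop using 2 with i
    change star (x.1 i * a.unop) * (x.1 i * a.unop) = _
    rw [star_mul]
    simp only [mul_assoc]
  rw [norm_def, h, norm_def, Real.sqrt_le_left (by positivity), mul_pow,
    Real.sq_sqrt (norm_nonneg _)]
  have h1 := norm_mul_le (star a.unop * ip x x) a.unop
  have h2 := norm_mul_le (star a.unop) (ip x x)
  rw [norm_star] at h2
  have : ‖a‖ = ‖a.unop‖ := rfl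
  rw [this]
  nlinarith [norm_nonneg a.unop]

instance : IsBoundedSMul Aᵐᵒᵖ (StdModule A) := IsBoundedSMul.of_norm_smul_le norm_op_smul_le

instance : CompleteSpace (StdModule A) := by
  refine Metric.complete_of_cauchySeq_tendsto fun u hu => ?_
  have hc : ∀ i, ∃ a, Tendsto (fun n => (u n).1 i) atTop (𝓝 a) := by
    intro i
    refine cauchySeq_tendsto_of_complete ?_
    rw [Metric.cauchySeq_iff'] at hu ⊢
    intro ε hε
    obtain ⟨N, hN⟩ := hu ε hε
    refine ⟨N, fun n hn => lt_of_le_of_lt ?_ (hN n hn)⟩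
    rw [dist_eq_norm, dist_eq_norm]
    exact norm_coord_le (u n - u N) i
  choose x hx using hc
  have key : ∀ ε > 0, ∃ N, ∀ n ≥ N, ∀ s : Finset ℕ,
      √‖∑ i ∈ s, star (x i - (u n).1 i) * (x i - (u n).1 i)‖ ≤ ε := by
    intro ε hε
    obtain ⟨N, hN⟩ := Metric.cauchySeq_iff.1 hu ε hε
    refine ⟨N, fun n hn s => ?_⟩
    have ht : Tendsto (fun m => √‖∑ i ∈ s, star ((u m).1 i - (u n).1 i) *
        ((u m).1 i - (u n).1 i)‖) atTop
        (𝓝 √‖∑ i ∈ s, star (x i - (u n).1 i) * (x i - (u n).1 i)‖) := by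
      refine (Real.continuous_sqrt.tendsto _).comp (Tendsto.norm ?_)
      refine tendsto_finsetSum _ fun i _ => ?_
      exact (((hx i).sub_const _).star).mul ((hx i).sub_const _)
    refine le_of_tendsto ht ?_
    filter_upwards [eventually_ge_atTop N] with m hm
    refine (sqrt_norm_sum_le (u m - u n) s).trans ?_
    rw [← dist_eq_norm]
    exact (hN m hm n hn).le
  have hmem : x ∈ stdSubmodule A := by
    change Summable fun i => star (x i) * x i
    rw [summable_iff_vanishing_norm]
    intro ε hε
    have hε' : 0 < √ε / 3 := by positivity
    obtain ⟨N, hN⟩ := key _ hε'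
    obtain ⟨s, hs⟩ := summable_iff_vanishing_norm.1 (u N).2 ((√ε / 3) ^ 2) (by positivity)
    refine ⟨s, fun t ht => ?_⟩
    have h1 := sqrt_norm_sum_add_le t (fun i => x i - (u N).1 i) (u N).1
    simp only [sub_add_cancel] at h1
    have h2 := hN N le_rfl t
    have h3 : √‖∑ i ∈ t, star ((u N).1 i) * (u N).1 i‖ ≤ √ε / 3 :=
      Real.sqrt_le_iff.2 ⟨hε'.le, (hs t ht).le⟩
    exact (Real.sqrt_lt_sqrt_iff (norm_nonneg _)).1 (by linarith)
  let y : StdModule A := ⟨x, hmem⟩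
  refine ⟨y, ?_⟩
  rw [tendsto_iff_norm_sub_tendsto_zero, Metric.tendsto_atTop]
  intro ε hε
  obtain ⟨N, hN⟩ := key (ε / 2) (by positivity)
  refine ⟨N, fun n hn => ?_⟩
  rw [Real.dist_0_eq_abs, abs_of_nonneg (norm_nonneg _), norm_sub_rev]
  refine lt_of_le_of_lt (le_of_tendsto' (tendsto_norm (y - u n)) fun s => hN n hn s) ?_
  linarith

/-- The operator `αI : x ↦ x α` for `α` in the center of `A`. -/
def centerMul (α : Subalgebra.center ℂ A) : StdModule A →L[Aᵐᵒᵖ] StdModule A where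
  toFun x := MulOpposite.op (α : A) • x
  map_add' := smul_add _
  map_smul' a x := by
    rw [RingHom.id_apply, smul_smul, smul_smul]
    congr 1
    exact MulOpposite.unop_injective ((Subalgebra.mem_center_iff.1 α.2 a.unop))
  cont := continuous_const_smul _

end StdModule

/-! ### The `K`-group -/

/-- Finitely generated projective modules over a ring. -/
structure FGProj (R : Type u) [Ring R] : Type (u + 1) where
  carrier : Type u
  [addCommGroup : AddCommGroup carrier]
  [module : Module R carrier]
  [finite : Module.Finite R carrier]
  [projective : Module.Projective R carrier]

attribute [instance] FGProj.addCommGroup FGProj.module FGProj.finite FGProj.projective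

section KGroup

variable (R : Type u) [Ring R]

/-- Isomorphism of finitely generated projective modules. -/
instance fgProjSetoid : Setoid (FGProj R) where
  r M N := Nonempty (M.carrier ≃ₗ[R] N.carrier)
  iseqv := ⟨fun _ => ⟨LinearEquiv.refl R _⟩, fun ⟨e⟩ => ⟨e.symm⟩, fun ⟨e⟩ ⟨f⟩ => ⟨e.trans f⟩⟩

/-- Isomorphism classes of finitely generated projective modules. -/
def ProjClass : Type (u + 1) := Quotient (fgProjSetoid R)

instance : Add (ProjClass R) :=
  ⟨Quotient.map₂ (fun M N => ⟨M.carrier × N.carrier⟩)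
    fun _ _ ⟨e⟩ _ _ ⟨f⟩ => ⟨e.prodCongr f⟩⟩

instance : Zero (ProjClass R) := ⟨Quotient.mk _ ⟨PUnit⟩⟩

/-- The isomorphism classes form a commutative monoid under direct sum. -/
instance : AddCommMonoid (ProjClass R) where
  add_assoc := by
    rintro ⟨M⟩ ⟨N⟩ ⟨P⟩
    exact Quotient.sound ⟨LinearEquiv.prodAssoc R M.carrier N.carrier P.carrier⟩
  zero_add := by
    rintro ⟨M⟩
    exact Quotient.sound ⟨LinearEquiv.uniqueProd⟩
  add_zero := by
    rintro ⟨M⟩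
    exact Quotient.sound ⟨LinearEquiv.prodUnique⟩
  add_comm := by
    rintro ⟨M⟩ ⟨N⟩
    exact Quotient.sound ⟨LinearEquiv.prodComm R M.carrier N.carrier⟩
  nsmul := nsmulRec

/-- The Grothendieck group of the monoid of isomorphism classes of finitely generated projective
`R`-modules. For `R = Aᵐᵒᵖ` these are the finitely generated projective right `A`-modules, and
this is the group `K(A) = K₀(A)`. -/
abbrev KGroup : Type (u + 1) := Algebra.GrothendieckAddGroup (ProjClass R)

/-- The class `[M]` in the `K`-group. -/
def KGroup.mk (M : Type u) [AddCommGroup M] [Module R M] [Module.Finite R M]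
    [Module.Projective R M] : KGroup R :=
  Algebra.GrothendieckAddGroup.of (Quotient.mk (fgProjSetoid R) ⟨M⟩)

end KGroup

/-! ### Closed finitely generated summands of the standard module are projective -/

namespace StdModule

/-- The `i`-th standard basis vector. -/
def basisVec (i : ℕ) : StdModule A :=
  ⟨Pi.single i 1, by
    change Summable _
    refine summable_of_ne_finset_zero (s := {i}) fun j hj => ?_
    have : j ≠ i := by simpa using hj
    simp [this]⟩

/-- The first `m` coordinates. -/
def trunc (m : ℕ) : StdModule A →ₗ[Aᵐᵒᵖ] (Fin m → Aᵐᵒᵖ) where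
  toFun x i := MulOpposite.op (x.1 i)
  map_add' _ _ := rfl
  map_smul' _ _ := rfl

/-- The inclusion of `Aᵐ`. -/
def incl (m : ℕ) : (Fin m → Aᵐᵒᵖ) →ₗ[Aᵐᵒᵖ] StdModule A :=
  Fintype.linearCombination Aᵐᵒᵖ fun i : Fin m => basisVec (i : ℕ)

theorem coord_incl_trunc (m : ℕ) (x : StdModule A) (j : ℕ) :
    (incl m (trunc m x)).1 j = if j < m then x.1 j else 0 := by
  have h : (incl m (trunc m x)).1 = ∑ i : Fin m, fun j => (basisVec (A := A) i).1 j * x.1 i := by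
    rw [incl, Fintype.linearCombination_apply]
    exact map_sum (stdSubmodule A).subtype _ _
  rw [h, Finset.sum_apply]
  simp only [basisVec, Pi.single_apply, ite_mul, one_mul, zero_mul]
  split_ifs with hj
  · rw [Finset.sum_eq_single ⟨j, hj⟩]
    · simp
    · intro b _ hb
      rw [if_neg]
      rintro rfl
      exact hb rfl
    · simp
  · refine Finset.sum_eq_zero fun b _ => if_neg ?_
    have := b.2
    omega

theorem tendsto_incl_trunc (x : StdModule A) :
    Tendsto (fun m => ‖incl m (trunc m x) - x‖) atTop (𝓝 0) := by
  rw [Metric.tendsto_atTop]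
  intro ε hε
  obtain ⟨s, hs⟩ := summable_iff_vanishing_norm.1 x.2 ((ε / 2) ^ 2) (by positivity)
  refine ⟨s.sup id + 1, fun m hm => ?_⟩
  rw [Real.dist_0_eq_abs, abs_of_nonneg (norm_nonneg _)]
  refine lt_of_le_of_lt (le_of_tendsto' (tendsto_norm _) fun t => ?_) (half_lt_self hε)
  have hc : ∀ j, (incl m (trunc m x) - x).1 j = if j < m then 0 else - x.1 j := by
    intro j
    change (incl m (trunc m x)).1 j - x.1 j = _
    rw [coord_incl_trunc]
    split_ifs <;> simp
  have hsum : ∑ i ∈ t, star ((incl m (trunc m x) - x).1 i) * (incl m (trunc m x) - x).1 i =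
      ∑ i ∈ t with ¬ i < m, star (x.1 i) * x.1 i := by
    rw [Finset.sum_filter]
    refine Finset.sum_congr rfl fun i _ => ?_
    rw [hc]
    split_ifs <;> simp
  rw [hsum]
  refine Real.sqrt_le_iff.2 ⟨by positivity, (hs _ ?_).le⟩
  rw [Finset.disjoint_left]
  intro i hi his
  have h1 : i ≤ s.sup id := Finset.le_sup (f := id) his
  have h2 := (Finset.mem_filter.1 hi).2
  omega

end StdModule

open StdModule in
/-- A finitely generated closed submodule with a closed complement is projective. -/
theorem projective_of_isCompl {M N : Submodule Aᵐᵒᵖ (StdModule A)}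
    (hM : IsClosed (M : Set (StdModule A))) (hN : IsClosed (N : Set (StdModule A)))
    (h : IsCompl M N) (hfg : N.FG) : Module.Projective Aᵐᵒᵖ N := by
  have hfin : Module.Finite Aᵐᵒᵖ N := Module.Finite.of_fg hfg
  have hcN : CompleteSpace N := hN.completeSpace_coe
  -- the bounded projection onto `N` along `M`
  let p : StdModule A →ₗ[Aᵐᵒᵖ] N := N.projectionOnto M h.symm
  have hpN : ∀ y : N, p y = y := fun y => Submodule.projectionOnto_apply_left h.symm y
  have hpb : ∃ K, 0 < K ∧ ∀ x, ‖p x‖ ≤ K * ‖x‖ := by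
    have h' : IsCompl (N.restrictScalars ℂ) (M.restrictScalars ℂ) := by
      rw [isCompl_iff, disjoint_iff, codisjoint_iff] at h ⊢
      constructor
      · ext x
        have := SetLike.ext_iff.1 h.1 x
        simp only [Submodule.mem_inf, Submodule.mem_bot, Submodule.restrictScalars_mem] at this ⊢
        tauto
      · ext x
        have := SetLike.ext_iff.1 h.2 x
        simp only [Submodule.mem_sup, Submodule.mem_top, iff_true,
          Submodule.restrictScalars_mem] at this ⊢
        obtain ⟨a, ha, b, hb, rfl⟩ := this
        exact ⟨b, hb, a, ha, add_comm _ _⟩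
    let q := (N.restrictScalars ℂ).projectionOntoL (M.restrictScalars ℂ)
      (Submodule.IsCompl.isTopCompl_of_isClosed h' hN hM)
    obtain ⟨K, hK, hq⟩ := q.bound
    refine ⟨K, hK, fun x => ?_⟩
    have hxM : x - p x ∈ M := by
      rw [← Submodule.ker_projectionOnto h.symm, LinearMap.mem_ker, map_sub]
      exact sub_eq_zero.2 (hpN (p x)).symm
    have h1 : q (x - p x) = 0 := Submodule.projectionOnto_apply_right h' ⟨x - p x, hxM⟩
    have h2 : q (p x : StdModule A) = p x := Submodule.projectionOnto_apply_left h' (p x)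
    have h3 : q x = p x := by rw [← h2, ← sub_eq_zero, ← map_sub, h1]
    calc ‖p x‖ = ‖q x‖ := by rw [h3]; rfl
      _ ≤ _ := hq x
  obtain ⟨K, hK, hp⟩ := hpb
  obtain ⟨n, f, hf⟩ := Module.Finite.exists_fin' Aᵐᵒᵖ N
  let g : Fin n → N := fun i => f (Pi.single i 1)
  have hfg' : ∀ v, f v = ∑ i, v i • g i := by
    intro v
    conv_lhs => rw [← (Pi.basisFun Aᵐᵒᵖ (Fin n)).sum_repr v]
    simp [g]
  let f' : (Fin n → Aᵐᵒᵖ) →L[ℂ] N :=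
    { toFun := f
      map_add' := map_add f
      map_smul' := fun c v => by
        rw [RingHom.id_apply, ← smul_one_smul Aᵐᵒᵖ c v, map_smul, smul_one_smul]
      cont := by
        change Continuous fun v => f v
        simp only [hfg']
        fun_prop }
  obtain ⟨C, hC, hpre⟩ := f'.exists_preimage_norm_le hf
  have ht : Tendsto (fun m => K * (C * ∑ i, ‖incl m (trunc m (g i : StdModule A)) - g i‖)) atTop
      (𝓝 0) := by
    have := tendsto_finsetSum Finset.univ fun i _ => tendsto_incl_trunc (g i : StdModule A)
    simpa using (this.const_mul C).const_mul K
  obtain ⟨m, hm⟩ := (ht.eventually_lt_const (show (0 : ℝ) < 1 / 2 by norm_num)).exists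
  let S : N →ₗ[Aᵐᵒᵖ] N := (p ∘ₗ incl m) ∘ₗ (trunc m ∘ₗ N.subtype)
  have hS : ∀ y, ‖y - S y‖ ≤ 1 / 2 * ‖y‖ := by
    intro y
    obtain ⟨v, hv, hvC⟩ := hpre y
    have hv' : y = ∑ i, v i • g i := by rw [← hfg']; exact hv.symm
    have h1 : S y - y = p (incl m (trunc m (y : StdModule A)) - y) := by
      rw [map_sub, hpN]; rfl
    have h2 : incl m (trunc m (y : StdModule A)) - (y : StdModule A) =
        ∑ i, v i • (incl m (trunc m (g i : StdModule A)) - (g i : StdModule A)) := by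
      conv_lhs => rw [hv']
      simp [smul_sub, Finset.sum_sub_distrib]
    rw [norm_sub_rev, h1]
    calc _ ≤ K * ‖incl m (trunc m (y : StdModule A)) - (y : StdModule A)‖ := hp _
      _ ≤ K * ∑ i, ‖v i • (incl m (trunc m (g i : StdModule A)) - (g i : StdModule A))‖ := by
        rw [h2]; gcongr; exact norm_sum_le _ _
      _ ≤ K * ∑ i, C * ‖y‖ * ‖incl m (trunc m (g i : StdModule A)) - (g i : StdModule A)‖ := by
        gcongr with i
        refine (norm_smul_le _ _).trans ?_
        gcongr
        exact (norm_le_pi_norm v i).trans hvC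
      _ = K * (C * ∑ i, ‖incl m (trunc m (g i : StdModule A)) - g i‖) * ‖y‖ := by
        rw [← Finset.mul_sum]; ring
      _ ≤ _ := by gcongr
  have hbij : Function.Bijective S := by
    let D : N →L[ℂ] N := LinearMap.mkContinuous
      { toFun := fun y => y - S y
        map_add' := fun y z => by rw [map_add]; abel
        map_smul' := fun c y => by
          rw [RingHom.id_apply, ← smul_one_smul Aᵐᵒᵖ c y, map_smul]
          exact (smul_sub ((c • 1 : Aᵐᵒᵖ)) y (S y)).symm.trans (smul_one_smul Aᵐᵒᵖ c (y - S y)) }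
      (1 / 2) hS
    have hD : ‖D‖ < 1 := lt_of_le_of_lt (LinearMap.mkContinuous_norm_le _ (by norm_num) _)
      (by norm_num)
    have hu : IsUnit (1 - D) := (Units.oneSub D hD).isUnit
    have hb := ContinuousLinearMap.isUnit_iff_bijective.1 hu
    have he : ⇑(1 - D) = S := by
      funext y
      change y - (y - S y) = S y
      abel
    rwa [he] at hb
  let e := LinearEquiv.ofBijective S hbij
  refine Module.Projective.of_split (trunc m ∘ₗ N.subtype)
    (e.symm.toLinearMap ∘ₗ (p ∘ₗ incl m)) ?_
  ext1 y
  exact e.symm_apply_apply y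

/-! ### Semi-Fredholm operators -/

variable (A) in
/-- `B^a(H_A)`: the bounded `A`-linear operators on `H_A` that have an adjoint. -/
def adjointable : Set (StdModule A →L[Aᵐᵒᵖ] StdModule A) :=
  {F | ∃ G : StdModule A →L[Aᵐᵒᵖ] StdModule A,
    ∀ x y, StdModule.ip (F x) y = StdModule.ip x (G y)}

/-- Closed submodules with `H_A = M₁ ⊕ N₁` and `H_A = M₂ ⊕ N₂` (direct sums that need not be
orthogonal) with respect to which `F` has the matrix `diag(F₁, F₄)`, where `F₁ : M₁ → M₂` is an
isomorphism. -/
structure Decomposition (F : StdModule A →L[Aᵐᵒᵖ] StdModule A) where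
  M₁ : Submodule Aᵐᵒᵖ (StdModule A)
  N₁ : Submodule Aᵐᵒᵖ (StdModule A)
  M₂ : Submodule Aᵐᵒᵖ (StdModule A)
  N₂ : Submodule Aᵐᵒᵖ (StdModule A)
  isClosed_M₁ : IsClosed (M₁ : Set (StdModule A))
  isClosed_N₁ : IsClosed (N₁ : Set (StdModule A))
  isClosed_M₂ : IsClosed (M₂ : Set (StdModule A))
  isClosed_N₂ : IsClosed (N₂ : Set (StdModule A))
  isCompl₁ : IsCompl M₁ N₁
  isCompl₂ : IsCompl M₂ N₂
  iso : ∃ e : M₁ ≃L[Aᵐᵒᵖ] M₂, ∀ x : M₁, (e x : StdModule A) = F x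
  map_N : ∀ x ∈ N₁, F x ∈ N₂

variable (A) in
/-- `MΦ₊(H_A)`: the upper semi-`A`-Fredholm operators. -/
def upperSemiFredholm : Set (StdModule A →L[Aᵐᵒᵖ] StdModule A) :=
  {F | F ∈ adjointable A ∧ ∃ D : Decomposition F, D.N₁.FG}

variable (A) in
/-- `MΦ₋(H_A)`: the lower semi-`A`-Fredholm operators. -/
def lowerSemiFredholm : Set (StdModule A →L[Aᵐᵒᵖ] StdModule A) :=
  {F | F ∈ adjointable A ∧ ∃ D : Decomposition F, D.N₂.FG}

/-- A decomposition in which both `N₁` and `N₂` are finitely generated. -/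
structure FredholmDecomposition (F : StdModule A →L[Aᵐᵒᵖ] StdModule A) extends
    Decomposition F where
  fg_N₁ : N₁.FG
  fg_N₂ : N₂.FG

variable (A) in
/-- `MΦ(H_A)`: the `A`-Fredholm operators. -/
def fredholm : Set (StdModule A →L[Aᵐᵒᵖ] StdModule A) :=
  {F | F ∈ adjointable A ∧ Nonempty (FredholmDecomposition F)}

/-- `[N₁] - [N₂]` in `K(A)`. -/
def FredholmDecomposition.index {F : StdModule A →L[Aᵐᵒᵖ] StdModule A}
    (D : FredholmDecomposition F) : KGroup Aᵐᵒᵖ :=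
  have : Module.Finite Aᵐᵒᵖ D.N₁ := Module.Finite.of_fg D.fg_N₁
  have : Module.Finite Aᵐᵒᵖ D.N₂ := Module.Finite.of_fg D.fg_N₂
  have : Module.Projective Aᵐᵒᵖ D.N₁ :=
    projective_of_isCompl D.isClosed_M₁ D.isClosed_N₁ D.isCompl₁ D.fg_N₁
  have : Module.Projective Aᵐᵒᵖ D.N₂ :=
    projective_of_isCompl D.isClosed_M₂ D.isClosed_N₂ D.isCompl₂ D.fg_N₂
  KGroup.mk Aᵐᵒᵖ D.N₁ - KGroup.mk Aᵐᵒᵖ D.N₂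

open Classical in
/-- The index of an `A`-Fredholm operator `F`: the class `[N₁] - [N₂]` for some (equivalently, by
the well-definedness of the index, any) decomposition. It is only used for `F ∈ MΦ(H_A)`. -/
def index (F : StdModule A →L[Aᵐᵒᵖ] StdModule A) : KGroup Aᵐᵒᵖ :=
  if h : Nonempty (FredholmDecomposition F) then h.some.index else 0

variable (A) in
/-- `MΦ₀(H_A)`: the `A`-Fredholm operators of index `0`. -/
def fredholmZero : Set (StdModule A →L[Aᵐᵒᵖ] StdModule A) :=
  {F | F ∈ fredholm A ∧ index F = 0}

/-! ### Generalized spectra in the center of `A` -/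

/-- `{α ∈ Z(A) | F - αI ∉ Φ}`. -/
def spectrumOf (Φ : Set (StdModule A →L[Aᵐᵒᵖ] StdModule A))
    (F : StdModule A →L[Aᵐᵒᵖ] StdModule A) : Set (Subalgebra.center ℂ A) :=
  {α | F - StdModule.centerMul α ∉ Φ}

/-- `σ_ew(F)`. -/
def sigmaW (F : StdModule A →L[Aᵐᵒᵖ] StdModule A) : Set (Subalgebra.center ℂ A) :=
  spectrumOf (fredholmZero A) F

/-- `σ_ef(F)`. -/
def sigmaF (F : StdModule A →L[Aᵐᵒᵖ] StdModule A) : Set (Subalgebra.center ℂ A) :=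
  spectrumOf (fredholm A) F

/-- `σ_eα(F)`. -/
def sigmaAlpha (F : StdModule A →L[Aᵐᵒᵖ] StdModule A) : Set (Subalgebra.center ℂ A) :=
  spectrumOf (upperSemiFredholm A) F

/-- `σ_eβ(F)`. -/
def sigmaBeta (F : StdModule A →L[Aᵐᵒᵖ] StdModule A) : Set (Subalgebra.center ℂ A) :=
  spectrumOf (lowerSemiFredholm A) F

/-- `σ_ek(F)`. -/
def sigmaK (F : StdModule A →L[Aᵐᵒᵖ] StdModule A) : Set (Subalgebra.center ℂ A) :=
  spectrumOf (upperSemiFredholm A ∪ lowerSemiFredholm A) F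

end SemiFredholm

end

/-!
Two facts about decompositions `H_A = M₁ ⊕ N₁ → M₂ ⊕ N₂` of an operator carry the argument.

*Stability.* If `F` has a decomposition, then every operator `G` near `F` has one with the same `N₂`
and with `N₁` replaced by an isomorphic submodule (`Decomposition.exists_of_near`). Indeed the
compression `M₁ → M₂` of `G` is close to that of `F`, hence invertible, and eliminating the
off-diagonal entries of the matrix of `G` changes only `M₂` and `N₁`. Consequently all the classes
of semi-Fredholm operators are open.

*Comparison.* Let the same operator have two decompositions, the second with complements `N₁'`,
`N₂'`. If `N₁` and `N₂'` are finitely generated, so is `N₂` (`Decomposition.fg_N₂_of_fg`), and if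
`N₂` and `N₁'` are finitely generated, so is `N₁` (`Decomposition.fg_N₁_of_fg`). There is an exact
sequence `0 → N₁ → N₂ × N₁' → N₂' → 0`, the mapping cone of the comparison of the two complexes
`N₁ → N₂` and `N₁' → N₂'`; it splits when `N₂'` is projective, so the index in the `K`-group does
not depend on the decomposition (`FredholmDecomposition.index_eq`). With stability, the index is
locally constant.

Each inclusion is then an instance of `frontier_spectrumOf_subset`. For classes `Φ ⊆ Ψ` with `Φ`
open and such that operators in `Ψ \ Φ` are not limits of operators in `Φ`, a boundary point of the
`Φ`-spectrum lies in the `Ψ`-spectrum, and hence on its boundary. That operators in `Ψ \ Φ` are not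
such limits follows, for index zero, from the local constancy of the index; in the other cases a
nearby operator inherits a complement that is not finitely generated, which the comparison forbids.

Adjointability plays no role beyond being shared by all `F - αI`: only bounded module maps occur.
-/

open Filter Topology

noncomputable section

namespace SemiFredholm

universe u

variable {A : Type u} [CStarAlgebra A]

/-! ### Bounded projections and small perturbations of the identity -/

/-- The projection onto a closed submodule along a closed complement is continuous. -/
theorem continuous_projectionOnto {M N : Submodule Aᵐᵒᵖ (StdModule A)}
    (hM : IsClosed (M : Set (StdModule A))) (hN : IsClosed (N : Set (StdModule A)))
    (h : IsCompl M N) : Continuous (M.projectionOnto N h) := by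
  have h' : IsCompl (M.restrictScalars ℂ) (N.restrictScalars ℂ) := by
    refine IsCompl.of_eq ?_ ?_
    · rw [← Submodule.restrictScalars_inf, h.inf_eq_bot]; rfl
    · rw [← Submodule.restrictScalars_sup, h.sup_eq_top]; rfl
  let q := (M.restrictScalars ℂ).projectionOntoL (N.restrictScalars ℂ)
    (Submodule.IsCompl.isTopCompl_of_isClosed h' hM hN)
  have hq : ∀ x, q x = M.projectionOnto N h x := fun x => by
    have h1 : q (M.projection N h x) = M.projectionOnto N h x :=
      Submodule.projectionOnto_apply_left h' (M.projectionOnto N h x)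
    have h2 : q (x - M.projection N h x) = 0 :=
      Submodule.projectionOnto_apply_right h' ⟨_, Submodule.sub_projection_mem h x⟩
    rw [← h1, ← sub_eq_zero, ← map_sub, h2]
  exact q.continuous.congr hq

/-- A module endomorphism close to the identity is an isomorphism. The Neumann series is summed
among the `ℂ`-linear endomorphisms, which form a Banach algebra. -/
theorem exists_equiv_of_norm_sub_le {M : Submodule Aᵐᵒᵖ (StdModule A)}
    (hM : IsClosed (M : Set (StdModule A))) (a : M →L[Aᵐᵒᵖ] M)
    (ha : ∀ x, ‖x - a x‖ ≤ 1 / 2 * ‖x‖) : ∃ e : M ≃L[Aᵐᵒᵖ] M, ∀ x, e x = a x := by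
  have : CompleteSpace M := hM.completeSpace_coe
  let R : M →L[ℂ] M := 1 - a.restrictScalars ℂ
  have hR : ‖R‖ < 1 :=
    (R.opNorm_le_bound (by norm_num) ha).trans_lt (by norm_num)
  let U : (M →L[ℂ] M)ˣ := Units.oneSub R hR
  have hU : ∀ x, (U : M →L[ℂ] M) x = a x := fun x => sub_sub_cancel x (a x)
  let B : M →L[ℂ] M := ↑U⁻¹
  have h1 : ∀ x, B (a x) = x := fun x => by
    rw [← hU]; exact congrArg (fun T : M →L[ℂ] M => T x) U.inv_mul
  have h2 : ∀ x, a (B x) = x := fun x => by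
    rw [← hU]; exact congrArg (fun T : M →L[ℂ] M => T x) U.mul_inv
  exact ⟨{ a with
    invFun := B
    left_inv := h1
    right_inv := h2
    continuous_toFun := a.continuous
    continuous_invFun := B.continuous }, fun _ => rfl⟩

/-! ### Stability of decompositions -/

/-- The decomposition of `G` determined by a closed submodule `M` and a bounded left inverse
`S : H_A → M` of the restriction of `G` to `M`: the isomorphic part of `G` is `M → G(M)`, and the
complements are the kernels of `S ∘ G` and of `S`. -/
def Decomposition.ofLeftInverse (G : StdModule A →L[Aᵐᵒᵖ] StdModule A)
    (M : Submodule Aᵐᵒᵖ (StdModule A)) (hM : IsClosed (M : Set (StdModule A)))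
    (S : StdModule A →L[Aᵐᵒᵖ] M) (hS : ∀ x : M, S (G x) = x) : Decomposition G where
  M₁ := M
  N₁ := (S ∘L G).ker
  M₂ := M.map (G : StdModule A →ₗ[Aᵐᵒᵖ] StdModule A)
  N₂ := S.ker
  isClosed_M₁ := hM
  isClosed_N₁ := (S ∘L G).isClosed_ker
  isClosed_M₂ := by
    have : (M.map (G : StdModule A →ₗ[Aᵐᵒᵖ] StdModule A) : Set (StdModule A)) =
        {y | G (S y) = y} := by
      ext y
      constructor
      · rintro ⟨x, hx, rfl⟩
        exact congrArg (fun z : M => G z) (hS ⟨x, hx⟩)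
      · intro hy
        exact ⟨S y, (S y).2, hy⟩
    rw [this]
    exact isClosed_eq (by fun_prop) continuous_id
  isClosed_N₂ := S.isClosed_ker
  isCompl₁ := LinearMap.isCompl_of_proj (f := (S ∘L G).toLinearMap) hS
  isCompl₂ := by
    refine ⟨Submodule.disjoint_def.2 ?_, codisjoint_iff_le_sup.2 fun y _ => ?_⟩
    · rintro _ ⟨x, hx, rfl⟩ h
      have : (⟨x, hx⟩ : M) = 0 := (hS ⟨x, hx⟩).symm.trans h
      rw [show x = 0 from congrArg Subtype.val this, map_zero]
    · refine Submodule.mem_sup.2 ⟨G (S y), ⟨S y, (S y).2, rfl⟩, y - G (S y), ?_, by abel⟩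
      change S (y - G (S y)) = 0
      rw [map_sub, hS, sub_self]
  iso := ⟨{ (G : StdModule A →ₗ[Aᵐᵒᵖ] StdModule A).submoduleMap M with
      invFun := fun y => S y
      left_inv := hS
      right_inv := by
        rintro ⟨_, x, hx, rfl⟩
        exact Subtype.ext (congrArg (fun z : M => G z) (hS ⟨x, hx⟩))
      continuous_toFun := (G.continuous.comp continuous_subtype_val).subtype_mk _
      continuous_invFun := S.continuous.comp continuous_subtype_val }, fun _ => rfl⟩
  map_N _ hx := hx

/-- Every operator near `F` has a decomposition whose complements `N₁` and `N₂` are isomorphic,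
respectively equal, to those of a given decomposition of `F`. The submodule `M₁` is kept: the
compression of the operator to `M₁ → M₂` stays invertible. -/
theorem Decomposition.exists_of_near {F : StdModule A →L[Aᵐᵒᵖ] StdModule A}
    (D : Decomposition F) : ∃ ε > 0, ∀ G : StdModule A →L[Aᵐᵒᵖ] StdModule A,
      (∀ x, ‖F x - G x‖ ≤ ε * ‖x‖) →
        ∃ D' : Decomposition G, Nonempty (D.N₁ ≃ₗ[Aᵐᵒᵖ] D'.N₁) ∧ D'.N₂ = D.N₂ := by
  obtain ⟨e, he⟩ := D.iso
  let Q : StdModule A →L[Aᵐᵒᵖ] D.M₂ :=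
    ⟨D.M₂.projectionOnto D.N₂ D.isCompl₂,
      continuous_projectionOnto D.isClosed_M₂ D.isClosed_N₂ D.isCompl₂⟩
  let S : StdModule A →L[Aᵐᵒᵖ] D.M₁ := (e.symm : D.M₂ →L[Aᵐᵒᵖ] D.M₁) ∘L Q
  have hSF : ∀ x : D.M₁, S (F x) = x := fun x => by
    rw [← he x]
    change e.symm (Q (e x)) = x
    rw [show Q (e x) = e x from Submodule.projectionOnto_apply_left D.isCompl₂ (e x),
      e.symm_apply_apply]
  obtain ⟨K, hK, hSK⟩ := (S.restrictScalars ℂ).bound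
  refine ⟨1 / (2 * K), by positivity, fun G hG => ?_⟩
  obtain ⟨e₀, he₀⟩ := exists_equiv_of_norm_sub_le D.isClosed_M₁ (S ∘L G ∘L D.M₁.subtypeL) <| by
    intro x
    have h1 : x - (S ∘L G ∘L D.M₁.subtypeL) x = S (F x - G x) := by
      rw [map_sub, hSF]; rfl
    rw [h1]
    calc ‖S (F x - G x)‖ ≤ K * ‖F x - G x‖ := hSK _
      _ ≤ K * (1 / (2 * K) * ‖(x : StdModule A)‖) := by gcongr; exact hG x
      _ = 1 / 2 * ‖x‖ := by rw [Submodule.coe_norm]; field_simp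
  let D' := Decomposition.ofLeftInverse G D.M₁ D.isClosed_M₁
    ((e₀.symm : D.M₁ →L[Aᵐᵒᵖ] D.M₁) ∘L S) fun x =>
      e₀.symm_apply_eq.2 (he₀ x).symm
  refine ⟨D', ⟨(D.M₁.quotientEquivOfIsCompl D.N₁ D.isCompl₁).symm.trans
    (D.M₁.quotientEquivOfIsCompl D'.N₁ D'.isCompl₁)⟩, ?_⟩
  ext y
  change e₀.symm (e.symm (Q y)) = 0 ↔ y ∈ D.N₂
  rw [e₀.symm.map_eq_zero_iff, e.symm.map_eq_zero_iff]
  exact Submodule.projectionOnto_apply_eq_zero_iff D.isCompl₂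

/-! ### Comparing two decompositions of the same operator -/

namespace Decomposition

variable {F : StdModule A →L[Aᵐᵒᵖ] StdModule A} (D D' : Decomposition F)

theorem map_mem_M₂ {x : StdModule A} (hx : x ∈ D.M₁) : F x ∈ D.M₂ := by
  obtain ⟨e, he⟩ := D.iso
  rw [← he ⟨x, hx⟩]
  exact (e _).2

theorem eq_zero_of_map_eq_zero {x : StdModule A} (hx : x ∈ D.M₁) (h : F x = 0) : x = 0 := by
  obtain ⟨e, he⟩ := D.iso
  have h0 : e ⟨x, hx⟩ = 0 := Subtype.ext ((he _).trans h)
  exact congrArg Subtype.val (e.map_eq_zero_iff.1 h0)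

theorem exists_map_eq {y : StdModule A} (hy : y ∈ D.M₂) : ∃ x ∈ D.M₁, F x = y := by
  obtain ⟨e, he⟩ := D.iso
  exact ⟨e.symm ⟨y, hy⟩, (e.symm _).2, by rw [← he, e.apply_symm_apply]⟩

/-- The projection onto `N₁` along `M₁`. -/
def projN₁ : StdModule A →ₗ[Aᵐᵒᵖ] D.N₁ := D.N₁.projectionOnto D.M₁ D.isCompl₁.symm

/-- The projection onto `N₂` along `M₂`. -/
def projN₂ : StdModule A →ₗ[Aᵐᵒᵖ] D.N₂ := D.N₂.projectionOnto D.M₂ D.isCompl₂.symm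

theorem sub_projN₁_mem (x : StdModule A) : x - D.projN₁ x ∈ D.M₁ :=
  Submodule.sub_projection_mem D.isCompl₁.symm x

theorem sub_projN₂_mem (y : StdModule A) : y - D.projN₂ y ∈ D.M₂ :=
  Submodule.sub_projection_mem D.isCompl₂.symm y

/-- `F` intertwines the projections, being diagonal with respect to the decomposition. -/
theorem projN₂_map (x : StdModule A) : (D.projN₂ (F x) : StdModule A) = F (D.projN₁ x) := by
  have h1 : D.projN₂ (F (x - D.projN₁ x)) = 0 :=
    Submodule.projectionOnto_apply_of_mem_right D.isCompl₂.symm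
      (D.map_mem_M₂ (D.sub_projN₁_mem x))
  have h2 : D.projN₂ (F (D.projN₁ x)) = ⟨_, D.map_N _ (D.projN₁ x).2⟩ :=
    Submodule.projectionOnto_apply_of_mem_left _ _
  rw [map_sub, map_sub, sub_eq_zero] at h1
  rw [h1, h2]

/-- A left inverse of `F` modulo `N₁`: the inverse of `F : M₁ → M₂`, extended by zero. -/
theorem exists_left_inverse_mod :
    ∃ S : StdModule A →ₗ[Aᵐᵒᵖ] StdModule A, ∀ x, S (F x) = x - D.projN₁ x := by
  obtain ⟨e, he⟩ := D.iso
  refine ⟨D.M₁.subtype ∘ₗ e.symm.toLinearEquiv.toLinearMap ∘ₗ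
    D.M₂.projectionOnto D.N₂ D.isCompl₂, fun x => ?_⟩
  have h1 : D.M₂.projectionOnto D.N₂ D.isCompl₂ (F x) = e ⟨_, D.sub_projN₁_mem x⟩ := by
    have hx : F x = e ⟨_, D.sub_projN₁_mem x⟩ + F (D.projN₁ x) := by
      rw [he, ← map_add, sub_add_cancel]
    rw [hx, map_add, Submodule.projectionOnto_apply_left,
      Submodule.projectionOnto_apply_of_mem_right _ (D.map_N _ (D.projN₁ x).2), add_zero]
  change ((e.symm (D.M₂.projectionOnto D.N₂ D.isCompl₂ (F x)) : D.M₁) : StdModule A) = _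
  rw [h1, e.symm_apply_apply]

/-- If `F` is upper semi-Fredholm by one decomposition and lower semi-Fredholm by another one, then
the first is a Fredholm decomposition: `H_A = F(M₁) + F(N₁) + N₂'`, so that `N₂` is the image of
`F(N₁) + N₂'` under the projection along `M₂ = F(M₁)`. -/
theorem fg_N₂_of_fg (h₁ : D.N₁.FG) (h₂ : D'.N₂.FG) : D.N₂.FG := by
  have key : D.N₂ = (D.N₁.map (F : StdModule A →ₗ[Aᵐᵒᵖ] StdModule A) ⊔ D'.N₂).map
      (D.N₂.subtype ∘ₗ D.projN₂) := by
    apply le_antisymm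
    · intro y hy
      obtain ⟨u, -, hu⟩ := D'.exists_map_eq (D'.sub_projN₂_mem y)
      refine ⟨F (D.projN₁ u) + D'.projN₂ y,
        Submodule.add_mem_sup ⟨_, (D.projN₁ u).2, rfl⟩ (D'.projN₂ y).2, ?_⟩
      have h1 : D.projN₂ (F (u - D.projN₁ u)) = 0 :=
        Submodule.projectionOnto_apply_of_mem_right D.isCompl₂.symm
          (D.map_mem_M₂ (D.sub_projN₁_mem u))
      have h2 : F (D.projN₁ u) + D'.projN₂ y = y - F (u - D.projN₁ u) := by
        rw [map_sub, hu]; abel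
      change (D.projN₂ (F (D.projN₁ u) + D'.projN₂ y) : StdModule A) = y
      rw [h2, map_sub, h1, sub_zero]
      exact congrArg Subtype.val
        (Submodule.projectionOnto_apply_of_mem_left D.isCompl₂.symm hy)
    · rintro _ ⟨y, -, rfl⟩
      exact (D.projN₂ y).2
  rw [key]
  exact ((h₁.map _).sup h₂).map _

/-- If `F` is lower semi-Fredholm by one decomposition and upper semi-Fredholm by another one, then
the first is a Fredholm decomposition: a left inverse `S` of `F` modulo `N₁'` gives
`N₁ ≤ N₁' + S(N₂)`. -/
theorem fg_N₁_of_fg (h₂ : D.N₂.FG) (h₁ : D'.N₁.FG) : D.N₁.FG := by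
  obtain ⟨S, hS⟩ := D'.exists_left_inverse_mod
  have key : D.N₁ = (D'.N₁ ⊔ D.N₂.map S).map (D.N₁.subtype ∘ₗ D.projN₁) := by
    apply le_antisymm
    · intro x hx
      refine ⟨x, ?_, congrArg Subtype.val
        (Submodule.projectionOnto_apply_of_mem_left D.isCompl₁.symm hx)⟩
      have h : x = D'.projN₁ x + S (F x) := by rw [hS]; abel
      rw [h]
      exact Submodule.add_mem_sup (D'.projN₁ x).2 ⟨_, D.map_N x hx, rfl⟩
    · rintro _ ⟨x, -, rfl⟩
      exact (D.projN₁ x).2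
  rw [key]
  exact (h₁.sup (h₂.map _)).map _

/-- The first map of the exact sequence `0 → N₁ → N₂ × N₁' → N₂' → 0` comparing two
decompositions: `x ↦ (F x, P' x)`. -/
def compareLeft : D.N₁ →ₗ[Aᵐᵒᵖ] D.N₂ × D'.N₁ :=
  ((F : StdModule A →ₗ[Aᵐᵒᵖ] StdModule A).restrict D.map_N).prod (D'.projN₁ ∘ₗ D.N₁.subtype)

/-- The second map of the exact sequence `0 → N₁ → N₂ × N₁' → N₂' → 0` comparing two
decompositions: `(y, z) ↦ P' y - F z`. -/
def compareRight : D.N₂ × D'.N₁ →ₗ[Aᵐᵒᵖ] D'.N₂ :=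
  (D'.projN₂ ∘ₗ D.N₂.subtype).coprod
    (-(F : StdModule A →ₗ[Aᵐᵒᵖ] StdModule A).restrict D'.map_N)

theorem coe_compareRight (p : D.N₂ × D'.N₁) :
    (D.compareRight D' p : StdModule A) = D'.projN₂ p.1 - F p.2 :=
  (sub_eq_add_neg _ _).symm

theorem compareLeft_injective : Function.Injective (D.compareLeft D') := by
  refine (injective_iff_map_eq_zero _).2 fun x hx => ?_
  have h1 : F x = 0 := congrArg (fun p => (p.1 : StdModule A)) hx
  have h2 : D'.projN₁ x = 0 := congrArg Prod.snd hx
  have h3 := D'.sub_projN₁_mem x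
  rw [h2, ZeroMemClass.coe_zero, sub_zero] at h3
  exact Subtype.ext (D'.eq_zero_of_map_eq_zero h3 h1)

theorem compareRight_surjective : Function.Surjective (D.compareRight D') := by
  intro w
  obtain ⟨u, -, hu⟩ := D.exists_map_eq (D.sub_projN₂_mem w)
  refine ⟨(D.projN₂ w, -D'.projN₁ u), Subtype.ext ?_⟩
  rw [coe_compareRight]
  have h1 : D'.projN₂ w = w := Submodule.projectionOnto_apply_left D'.isCompl₂.symm w
  have h2 := D'.projN₂_map u
  rw [hu, map_sub, h1] at h2
  simp only [NegMemClass.coe_neg, map_neg, ← h2, AddSubgroupClass.coe_sub]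
  abel

theorem compare_exact : Function.Exact (D.compareLeft D') (D.compareRight D') := by
  rintro ⟨y, z⟩
  constructor
  · intro h
    have h1 : (D'.projN₂ y : StdModule A) = F z := by
      rw [← sub_eq_zero, ← D.coe_compareRight D' (y, z), h, ZeroMemClass.coe_zero]
    obtain ⟨u, hu, hFu⟩ := D'.exists_map_eq (D'.sub_projN₂_mem (y : StdModule A))
    have hy : F (z + u) = y := by rw [map_add, hFu, h1]; abel
    have hz : D'.projN₁ (z + u) = z := by
      rw [map_add, show D'.projN₁ z = z from Submodule.projectionOnto_apply_left _ z,
        show D'.projN₁ u = 0 from Submodule.projectionOnto_apply_of_mem_right _ hu, add_zero]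
    -- the `M₁`-component of `z + u` is killed by `F`, because `F (z + u)` lies in `N₂`
    have h2 : F (z + u - D.projN₁ (z + u)) = 0 := by
      rw [map_sub, ← D.projN₂_map, hy, show D.projN₂ y = y from
        Submodule.projectionOnto_apply_left _ y, sub_self]
    have h3 := D.eq_zero_of_map_eq_zero (D.sub_projN₁_mem _) h2
    have h4 : (z + u : StdModule A) ∈ D.N₁ := by
      rw [sub_eq_zero.1 h3]
      exact (D.projN₁ _).2
    exact ⟨⟨_, h4⟩, Prod.ext (Subtype.ext hy) hz⟩
  · rintro ⟨x, hx⟩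
    have h1 : F x = y := congrArg (fun p => (p.1 : StdModule A)) hx
    have h2 : D'.projN₁ x = z := congrArg Prod.snd hx
    refine Subtype.ext ?_
    rw [coe_compareRight]
    change (D'.projN₂ y : StdModule A) - F z = 0
    rw [← h1, ← h2, D'.projN₂_map, sub_self]

end Decomposition

/-! ### The index -/

theorem KGroup.mk_eq_of_equiv {R : Type u} [Ring R] {M N : Type u} [AddCommGroup M] [Module R M]
    [Module.Finite R M] [Module.Projective R M] [AddCommGroup N] [Module R N] [Module.Finite R N]
    [Module.Projective R N] (e : M ≃ₗ[R] N) : KGroup.mk R M = KGroup.mk R N :=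
  congrArg Algebra.GrothendieckAddGroup.of (Quotient.sound (s := fgProjSetoid R) ⟨e⟩)

theorem KGroup.mk_prod {R : Type u} [Ring R] (M N : Type u) [AddCommGroup M] [Module R M]
    [Module.Finite R M] [Module.Projective R M] [AddCommGroup N] [Module R N] [Module.Finite R N]
    [Module.Projective R N] : KGroup.mk R (M × N) = KGroup.mk R M + KGroup.mk R N :=
  let m : ProjClass R := Quotient.mk _ ⟨M⟩
  let n : ProjClass R := Quotient.mk _ ⟨N⟩
  map_add Algebra.GrothendieckAddGroup.of m n

/-- The index does not depend on the decomposition: the exact sequence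
`0 → N₁ → N₂ × N₁' → N₂' → 0` splits, so that `N₂ × N₁' ≃ N₁ × N₂'`. -/
theorem FredholmDecomposition.index_eq {F : StdModule A →L[Aᵐᵒᵖ] StdModule A}
    (D D' : FredholmDecomposition F) : D.index = D'.index := by
  have : Module.Finite Aᵐᵒᵖ D.N₁ := Module.Finite.of_fg D.fg_N₁
  have : Module.Finite Aᵐᵒᵖ D.N₂ := Module.Finite.of_fg D.fg_N₂
  have : Module.Projective Aᵐᵒᵖ D.N₁ :=
    projective_of_isCompl D.isClosed_M₁ D.isClosed_N₁ D.isCompl₁ D.fg_N₁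
  have : Module.Projective Aᵐᵒᵖ D.N₂ :=
    projective_of_isCompl D.isClosed_M₂ D.isClosed_N₂ D.isCompl₂ D.fg_N₂
  have : Module.Finite Aᵐᵒᵖ D'.N₁ := Module.Finite.of_fg D'.fg_N₁
  have : Module.Finite Aᵐᵒᵖ D'.N₂ := Module.Finite.of_fg D'.fg_N₂
  have : Module.Projective Aᵐᵒᵖ D'.N₁ :=
    projective_of_isCompl D'.isClosed_M₁ D'.isClosed_N₁ D'.isCompl₁ D'.fg_N₁
  have : Module.Projective Aᵐᵒᵖ D'.N₂ :=
    projective_of_isCompl D'.isClosed_M₂ D'.isClosed_N₂ D'.isCompl₂ D'.fg_N₂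
  obtain ⟨l, hl⟩ := Module.projective_lifting_property
    (D.compareRight D'.toDecomposition) LinearMap.id (D.compareRight_surjective _)
  have e := ((D.compare_exact D'.toDecomposition).splitSurjectiveEquiv
    (D.compareLeft_injective _) ⟨l, hl⟩).1
  have h := KGroup.mk_eq_of_equiv e
  rw [KGroup.mk_prod, KGroup.mk_prod] at h
  change KGroup.mk Aᵐᵒᵖ D.N₁ - KGroup.mk Aᵐᵒᵖ D.N₂ = KGroup.mk Aᵐᵒᵖ D'.N₁ - KGroup.mk Aᵐᵒᵖ D'.N₂
  rw [sub_eq_sub_iff_add_eq_add, ← h, add_comm]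

theorem FredholmDecomposition.index_eq_index {F : StdModule A →L[Aᵐᵒᵖ] StdModule A}
    (D : FredholmDecomposition F) : SemiFredholm.index F = D.index := by
  rw [SemiFredholm.index, dif_pos ⟨D⟩]
  exact index_eq _ _

/-- Isomorphic complements give equal indices, also for decompositions of different operators. -/
theorem FredholmDecomposition.index_eq_of_equiv {F G : StdModule A →L[Aᵐᵒᵖ] StdModule A}
    (D : FredholmDecomposition F) (D' : FredholmDecomposition G)
    (e₁ : D.N₁ ≃ₗ[Aᵐᵒᵖ] D'.N₁) (e₂ : D.N₂ ≃ₗ[Aᵐᵒᵖ] D'.N₂) : D.index = D'.index := by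
  unfold FredholmDecomposition.index
  dsimp only
  generalize_proofs
  exact congrArg₂ _ (KGroup.mk_eq_of_equiv e₁) (KGroup.mk_eq_of_equiv e₂)

/-! ### Semi-Fredholm points of the center -/

namespace StdModule

theorem ip_sub_left (x x' y : StdModule A) : ip (x - x') y = ip x y - ip x' y := by
  refine (hasSum_ip (x - x') y).unique ?_
  convert! (hasSum_ip x y).sub (hasSum_ip x' y) using 2 with i
  rw [← sub_mul, ← star_sub]
  rfl

theorem ip_sub_right (x y y' : StdModule A) : ip x (y - y') = ip x y - ip x y' := by
  refine (hasSum_ip x (y - y')).unique ?_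
  convert! (hasSum_ip x y).sub (hasSum_ip x y') using 2 with i
  rw [← mul_sub]
  rfl

/-- The adjoint of `αI` is `α*I`. -/
theorem ip_centerMul_left (α : Subalgebra.center ℂ A) (x y : StdModule A) :
    ip (centerMul α x) y = ip x (centerMul ⟨star α.1, Set.star_mem_center α.2⟩ y) := by
  refine tsum_congr fun i => ?_
  change star (x.1 i * α.1) * y.1 i = star (x.1 i) * (y.1 i * star α.1)
  have h : ∀ b, b * star α.1 = star α.1 * b :=
    Subalgebra.mem_center_iff (R := ℂ).1 (Set.star_mem_center α.2)
  rw [star_mul, ← mul_assoc (star (x.1 i)), h, mul_assoc]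

theorem norm_centerMul_le (α : Subalgebra.center ℂ A) (x : StdModule A) :
    ‖centerMul α x‖ ≤ ‖α‖ * ‖x‖ :=
  norm_op_smul_le _ x

end StdModule

theorem sub_centerMul_mem_adjointable {F : StdModule A →L[Aᵐᵒᵖ] StdModule A}
    (hF : F ∈ adjointable A) (α : Subalgebra.center ℂ A) :
    F - StdModule.centerMul α ∈ adjointable A := by
  obtain ⟨G, hG⟩ := hF
  refine ⟨G - StdModule.centerMul ⟨star α.1, Set.star_mem_center α.2⟩, fun x y => ?_⟩
  rw [sub_apply, sub_apply, StdModule.ip_sub_left,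
    StdModule.ip_sub_right, hG, StdModule.ip_centerMul_left]

theorem Decomposition.eventually_exists {F : StdModule A →L[Aᵐᵒᵖ] StdModule A}
    {α : Subalgebra.center ℂ A} (D : Decomposition (F - StdModule.centerMul α)) :
    ∀ᶠ β in 𝓝 α, ∃ D' : Decomposition (F - StdModule.centerMul β),
      Nonempty (D.N₁ ≃ₗ[Aᵐᵒᵖ] D'.N₁) ∧ D'.N₂ = D.N₂ := by
  obtain ⟨ε, hε, h⟩ := D.exists_of_near
  filter_upwards [Metric.ball_mem_nhds α hε] with β hβ
  refine h _ fun x => ?_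
  have h1 : (F - StdModule.centerMul α) x - (F - StdModule.centerMul β) x =
      StdModule.centerMul (β - α) x := by
    change F x - MulOpposite.op α.1 • x - (F x - MulOpposite.op β.1 • x) =
      MulOpposite.op (β.1 - α.1) • x
    rw [MulOpposite.op_sub, sub_smul]
    abel
  rw [h1]
  refine (StdModule.norm_centerMul_le _ x).trans ?_
  gcongr
  rw [← dist_eq_norm]
  exact (Metric.mem_ball.1 hβ).le

theorem fg_of_equiv {R M : Type*} [Ring R] [AddCommGroup M] [Module R M] {N N' : Submodule R M}
    (e : N ≃ₗ[R] N') (h : N.FG) : N'.FG :=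
  have := Module.Finite.of_fg h
  Module.Finite.iff_fg.1 (Module.Finite.equiv e)

theorem FredholmDecomposition.eventually_exists {F : StdModule A →L[Aᵐᵒᵖ] StdModule A}
    {α : Subalgebra.center ℂ A} (D : FredholmDecomposition (F - StdModule.centerMul α)) :
    ∀ᶠ β in 𝓝 α, ∃ D' : FredholmDecomposition (F - StdModule.centerMul β),
      D'.index = D.index := by
  filter_upwards [D.toDecomposition.eventually_exists] with β
  rintro ⟨D', ⟨e⟩, h⟩
  exact ⟨⟨D', fg_of_equiv e D.fg_N₁, h ▸ D.fg_N₂⟩,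
    (D.index_eq_of_equiv _ e (LinearEquiv.ofEq _ _ h.symm)).symm⟩

/-- Complements `U ⊆ V` of two spectra: if `U` is open and is moreover open-closed relative to
`V`, then the boundary of `U` avoids `V`, hence lies in the boundary of `V`. -/
theorem frontier_spectrumOf_subset {Φ Ψ : Set (StdModule A →L[Aᵐᵒᵖ] StdModule A)}
    {F : StdModule A →L[Aᵐᵒᵖ] StdModule A} (hΦΨ : Φ ⊆ Ψ)
    (hΦ : ∀ α, F - StdModule.centerMul α ∈ Φ → ∀ᶠ β in 𝓝 α, F - StdModule.centerMul β ∈ Φ)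
    (hΨ : ∀ α, F - StdModule.centerMul α ∈ Ψ → F - StdModule.centerMul α ∉ Φ →
      ∀ᶠ β in 𝓝 α, F - StdModule.centerMul β ∉ Φ) :
    frontier (spectrumOf Φ F) ⊆ frontier (spectrumOf Ψ F) := by
  intro α hα
  rw [frontier_eq_closure_inter_closure] at hα ⊢
  have h1 : α ∈ spectrumOf Φ F := fun h => by
    obtain ⟨β, hβ, hβ'⟩ := (mem_closure_iff_frequently.1 hα.1).and_eventually (hΦ α h) |>.exists
    exact hβ hβ'
  have h2 : α ∈ spectrumOf Ψ F := fun h => by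
    obtain ⟨β, hβ, hβ'⟩ :=
      (mem_closure_iff_frequently.1 hα.2).and_eventually (hΨ α h h1) |>.exists
    exact hβ hβ'
  have h3 : spectrumOf Ψ F ⊆ spectrumOf Φ F := fun β hβ h => hβ (hΦΨ h)
  exact ⟨subset_closure h2, closure_mono (Set.compl_subset_compl.2 h3) hα.2⟩

variable {F : StdModule A →L[Aᵐᵒᵖ] StdModule A} {α : Subalgebra.center ℂ A}

theorem fredholm_subset_upperSemiFredholm : fredholm A ⊆ upperSemiFredholm A :=
  fun _ ⟨h, ⟨D⟩⟩ => ⟨h, D.toDecomposition, D.fg_N₁⟩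

theorem fredholm_subset_lowerSemiFredholm : fredholm A ⊆ lowerSemiFredholm A :=
  fun _ ⟨h, ⟨D⟩⟩ => ⟨h, D.toDecomposition, D.fg_N₂⟩

theorem eventually_mem_fredholm (h : F - StdModule.centerMul α ∈ fredholm A)
    (hF : F ∈ adjointable A) : ∀ᶠ β in 𝓝 α, F - StdModule.centerMul β ∈ fredholm A := by
  obtain ⟨-, ⟨D⟩⟩ := h
  filter_upwards [D.eventually_exists] with β ⟨D', _⟩
  exact ⟨sub_centerMul_mem_adjointable hF β, ⟨D'⟩⟩

/-- The index is locally constant on the Fredholm operators `F - αI`. -/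
theorem eventually_index_eq (h : F - StdModule.centerMul α ∈ fredholm A) :
    ∀ᶠ β in 𝓝 α, index (F - StdModule.centerMul β) = index (F - StdModule.centerMul α) := by
  obtain ⟨-, ⟨D⟩⟩ := h
  filter_upwards [D.eventually_exists] with β ⟨D', h⟩
  rw [D'.index_eq_index, D.index_eq_index, h]

theorem eventually_mem_upperSemiFredholm (h : F - StdModule.centerMul α ∈ upperSemiFredholm A)
    (hF : F ∈ adjointable A) :
    ∀ᶠ β in 𝓝 α, F - StdModule.centerMul β ∈ upperSemiFredholm A := by
  obtain ⟨-, D, hD⟩ := h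
  filter_upwards [D.eventually_exists] with β ⟨D', ⟨e⟩, _⟩
  exact ⟨sub_centerMul_mem_adjointable hF β, D', fg_of_equiv e hD⟩

theorem eventually_mem_lowerSemiFredholm (h : F - StdModule.centerMul α ∈ lowerSemiFredholm A)
    (hF : F ∈ adjointable A) :
    ∀ᶠ β in 𝓝 α, F - StdModule.centerMul β ∈ lowerSemiFredholm A := by
  obtain ⟨-, D, hD⟩ := h
  filter_upwards [D.eventually_exists] with β ⟨D', _, hD'⟩
  exact ⟨sub_centerMul_mem_adjointable hF β, D', hD' ▸ hD⟩

/-- An upper semi-Fredholm operator that is not Fredholm is not a limit of lower semi-Fredholm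
ones: nearby operators inherit its complement `N₂`, which is not finitely generated. -/
theorem eventually_notMem_lowerSemiFredholm
    (h : F - StdModule.centerMul α ∈ upperSemiFredholm A)
    (h' : F - StdModule.centerMul α ∉ fredholm A) :
    ∀ᶠ β in 𝓝 α, F - StdModule.centerMul β ∉ lowerSemiFredholm A := by
  obtain ⟨ha, D, hD⟩ := h
  filter_upwards [D.eventually_exists] with β ⟨D', ⟨e⟩, hD'⟩ ⟨_, D'', h''⟩
  exact h' ⟨ha, ⟨⟨D, hD, hD' ▸ D'.fg_N₂_of_fg D'' (fg_of_equiv e hD) h''⟩⟩⟩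

/-- A lower semi-Fredholm operator that is not Fredholm is not a limit of upper semi-Fredholm
ones: nearby operators inherit its complement `N₁`, which is not finitely generated. -/
theorem eventually_notMem_upperSemiFredholm
    (h : F - StdModule.centerMul α ∈ lowerSemiFredholm A)
    (h' : F - StdModule.centerMul α ∉ fredholm A) :
    ∀ᶠ β in 𝓝 α, F - StdModule.centerMul β ∉ upperSemiFredholm A := by
  obtain ⟨ha, D, hD⟩ := h
  filter_upwards [D.eventually_exists] with β ⟨D', ⟨e⟩, hD'⟩ ⟨_, D'', h''⟩
  exact h' ⟨ha, ⟨⟨D, fg_of_equiv e.symm (D'.fg_N₁_of_fg D'' (hD'.symm ▸ hD) h''), hD⟩⟩⟩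

end SemiFredholm

end

open SemiFredholm in
theorem theorem4p2 {A : Type*} [CStarAlgebra A]
    (F : SemiFredholm.StdModule A →L[Aᵐᵒᵖ] SemiFredholm.StdModule A)
    (hF : F ∈ SemiFredholm.adjointable A) :
    frontier (SemiFredholm.sigmaW F) ⊆ frontier (SemiFredholm.sigmaF F) ∧
    frontier (SemiFredholm.sigmaF F) ⊆ frontier (SemiFredholm.sigmaBeta F) ∧
    frontier (SemiFredholm.sigmaF F) ⊆ frontier (SemiFredholm.sigmaAlpha F) ∧
    frontier (SemiFredholm.sigmaBeta F) ⊆ frontier (SemiFredholm.sigmaK F) ∧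
    frontier (SemiFredholm.sigmaAlpha F) ⊆ frontier (SemiFredholm.sigmaK F) := by
  refine ⟨frontier_spectrumOf_subset (fun _ h => h.1) (fun α h => ?_) (fun α h h' => ?_),
    frontier_spectrumOf_subset fredholm_subset_lowerSemiFredholm
      (fun α h => eventually_mem_fredholm h hF) (fun α h h' => ?_),
    frontier_spectrumOf_subset fredholm_subset_upperSemiFredholm
      (fun α h => eventually_mem_fredholm h hF) (fun α h h' => ?_),
    frontier_spectrumOf_subset Set.subset_union_right
      (fun α h => eventually_mem_lowerSemiFredholm h hF) (fun α h h' => ?_),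
    frontier_spectrumOf_subset Set.subset_union_left
      (fun α h => eventually_mem_upperSemiFredholm h hF) (fun α h h' => ?_)⟩
  · filter_upwards [eventually_mem_fredholm h.1 hF, eventually_index_eq h.1] with β h₁ h₂
    exact ⟨h₁, h₂.trans h.2⟩
  · filter_upwards [eventually_index_eq h] with β h₁ h₂
    exact h' ⟨h, h₁.symm.trans h₂.2⟩
  · filter_upwards [eventually_notMem_upperSemiFredholm h h'] with β hβ hβ'
    exact hβ (fredholm_subset_upperSemiFredholm hβ')
  · filter_upwards [eventually_notMem_lowerSemiFredholm h h'] with β hβ hβ'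
    exact hβ (fredholm_subset_lowerSemiFredholm hβ')
  · exact eventually_notMem_lowerSemiFredholm (h.resolve_right h') fun h₁ =>
      h' (fredholm_subset_lowerSemiFredholm h₁)
  · exact eventually_notMem_upperSemiFredholm (h.resolve_left h') fun h₁ =>
      h' (fredholm_subset_upperSemiFredholm h₁)
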